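/- Let $\sigma>0$ and let $f$ be an entire function of exponential type at most $\sigma$, i.e. for every $\varepsilon>0$ there is $c>0$ such that $|f(z)|\le c\,e^{(\sigma+\varepsilon)|z|}$ for all $z\in\mathbb{C}$. Suppose that $f$ is bounded on $\mathbb{R}$, and put $\|f\|_{L^\infty(\mathbb{R})}=\sup_{x\in\mathbb{R}}|f(x)|$. Let $\beta(t)=2\sin(t/2)$ for $0\le t\le\pi$ and $\beta(t)=2$ for $t>\pi$. Then for any bounded self-adjoint operators $A$ and $B$ on a complex Hilbert space, $$\|f(A)-f(B)\|\le\beta(\sigma\|A-B\|)\,\|f\|_{L^\infty(\mathbb{R})}\le\sigma\,\|f\|_{L^\infty(\mathbb{R})}\,\|A-B\|.$$ In particular, $f|_{\mathbb{R}}$ belongs to the class $\mathrm{OL}(\mathbb{R})$ of operator Lipschitz functions, and $\|f\|_{\mathrm{OL}(\mathbb{R})}\le\sigma\|f\|_{L^\infty(\mathbb{R})}$. Here, for a continuous function $g:\mathbb{R}\to\mathbb{C}$, $$\|g\|_{\mathrm{OL}(\mathbb{R})}=\sup\frac{\|g(A)-g(B)\|}{\|A-B\|}\in[0,\infty],$$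 the supremum being over all bounded self-adjoint operators $A\ne B$ on a common complex Hilbert space, and $g\in\mathrm{OL}(\mathbb{R})$ means that $\|g\|_{\mathrm{OL}(\mathbb{R})}<\infty$. -/

import Mathlib

open scoped ENNReal

universe u

noncomputable section

namespace OperatorBernstein

/-- `f` is an entire function of exponential type at most `σ`: for every `ε > 0` there is `c > 0`
with `|f z| ≤ c * exp ((σ + ε) * |z|)` for all complex `z`. -/
def IsEntireOfExpType (σ : ℝ) (f : ℂ → ℂ) : Prop :=
  Differentiable ℂ f ∧
    ∀ ε : ℝ, 0 < ε → ∃ c : ℝ, 0 < c ∧ ∀ z : ℂ, ‖f z‖ ≤ c * Real.exp ((σ + ε) * ‖z‖)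

/-- `g` is bounded on the real line. -/
def IsBoundedOnReal (g : ℝ → ℂ) : Prop :=
  BddAbove (Set.range fun x : ℝ => ‖g x‖)

/-- The supremum `sup |g x|` over real `x` (meaningful for bounded `g`). -/
def supNorm (g : ℝ → ℂ) : ℝ :=
  ⨆ x : ℝ, ‖g x‖

/-- The function `β`, used for arguments `t ≥ 0` only. -/
def beta (t : ℝ) : ℝ :=
  if t ≤ Real.pi then 2 * Real.sin (t / 2) else 2

section Calculus

variable {H : Type*} [NormedAddCommGroup H] [InnerProductSpace ℂ H] [CompleteSpace H]

/-- `g(A)` for a bounded self-adjoint operator `A` on a complex Hilbert space and a continuous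
function `g : ℝ → ℂ`. Since the values of `g` are complex, the continuous functional calculus over
`ℂ` is used; the spectrum of `A` is real, so only the values of `g` on it matter. -/
def opFun (g : ℝ → ℂ) (A : H →L[ℂ] H) : H →L[ℂ] H :=
  cfc (fun z : ℂ => g z.re) A

end Calculus

/-- The operator Lipschitz seminorm of a continuous function `g : ℝ → ℂ`: the supremum, possibly
`∞`, of `‖g(A) - g(B)‖ / ‖A - B‖` over all distinct bounded self-adjoint operators `A`, `B` on a
complex Hilbert space. -/
def olNorm (g : ℝ → ℂ) : ℝ≥0∞ :=
  ⨆ (H : Type u) (_ : NormedAddCommGroup H) (_ : InnerProductSpace ℂ H) (_ : CompleteSpace H)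
    (A : H →L[ℂ] H) (B : H →L[ℂ] H) (_ : IsSelfAdjoint A) (_ : IsSelfAdjoint B) (_ : A ≠ B),
    ENNReal.ofReal (‖opFun g A - opFun g B‖ / ‖A - B‖)

/-- The class `OL(ℝ)` of operator Lipschitz functions on the real line. -/
def IsOperatorLipschitz (g : ℝ → ℂ) : Prop :=
  Continuous g ∧ olNorm.{u} g < ∞

end OperatorBernstein

end

/-!
Bernstein's inequality for operators is reduced to the scalar inequality for increments. With
`K = B - A`, the function `F z = f (A + z K)`, defined by the Taylor series of `f`, is entire. The
majorant series `∑ |aₙ| rⁿ` has the same exponential type as `f`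
(`IsEntireOfExpType.exists_tsum_norm_le`), so `F` has exponential type at most `σ ‖K‖`. For real
`x` the operator `A + x K` is self-adjoint and the series agrees with the continuous functional
calculus (`hasSum_opFun`); hence `F` is bounded on the real line by the supremum of `|f|` there. For
a functional `φ` of norm at most one, `φ ∘ F` (`pencilFun`) inherits all this, and it suffices to
bound `φ (F 0) - φ (F 1)`.

The scalar inequality `|g h - g (-h)| ≤ 2 sin h * sup |g|`, for `g` of type `1` and `0 < h < π / 2`,
comes from an interpolation formula. By Phragmén–Lindelöf, `|g z| ≤ M exp |Im z|`, where `M` is a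
bound of `|g|` on the real line. So the integral of `g z / ((z² - h²) cos z)` over the circle
`|z| = N π` tends to zero, and the residues (`circleIntegral_eq_sum_residues`) give
`g h - g (-h) = 2 h cos h ∑ g s / ((s² - h²) sin s)`, summed over the zeros `s` of the cosine. Here
`|sin s| = 1` and `s² > h²`. For `g = sin` every term is positive and the sum is `2 sin h`, so the
sum of the moduli of the coefficients is `2 sin h` (`norm_sub_neg_le_of_exp_abs_im`).
-/

namespace OperatorBernstein

open Complex Filter Topology Metric Set Asymptotics
open scoped Real

/-! ### Growth of entire functions bounded on the real line -/

/-- Phragmén–Lindelöf in the upper half-plane, applied to `g z * exp (i (σ + ε) z)`, which is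
bounded on the positive imaginary axis. -/
theorem IsEntireOfExpType.norm_le_mul_exp_im {σ M : ℝ} {g : ℂ → ℂ} (hg : IsEntireOfExpType σ g)
    (hM : ∀ x : ℝ, ‖g x‖ ≤ M) {z : ℂ} (hz : 0 ≤ z.im) : ‖g z‖ ≤ M * Real.exp (σ * z.im) := by
  obtain ⟨hd, hexp⟩ := hg
  have key : ∀ ε : ℝ, 0 < ε → ‖g z‖ ≤ M * Real.exp ((σ + ε) * z.im) := by
    intro ε hε
    obtain ⟨c, hc, hgc⟩ := hexp ε hε
    set s := σ + ε
    have hn : ∀ w : ℂ, ‖g (I * w) * cexp (-(s * w))‖ = ‖g (I * w)‖ * Real.exp (-(s * w.re)) := by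
      intro w
      rw [norm_mul, Complex.norm_exp]
      simp
    have h := PhragmenLindelof.right_half_plane_of_bounded_on_real (C := M)
      (f := fun w : ℂ => g (I * w) * cexp (-(s * w))) (z := -I * z) ?_ ?_ ?_ ?_ (by simpa using hz)
    · rw [hn] at h
      have h1 : I * (-I * z) = z := by rw [← mul_assoc]; simp
      have h2 : (-I * z).re = z.im := by simp
      rw [h1, h2] at h
      rwa [Real.exp_neg, ← div_eq_mul_inv, div_le_iff₀ (Real.exp_pos _)] at h
    · apply Differentiable.diffContOnCl
      fun_prop
    · refine ⟨1, by norm_num, |s| + |s|, ?_⟩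
      refine IsBigO.of_bound c (Eventually.of_forall fun w => ?_)
      have h1 : ‖g (I * w)‖ ≤ c * Real.exp (s * ‖w‖) := by simpa using hgc (I * w)
      rw [hn, Real.norm_of_nonneg (Real.exp_pos _).le, Real.rpow_one]
      have h2 : s * ‖w‖ ≤ |s| * ‖w‖ := mul_le_mul_of_nonneg_right (le_abs_self s) (norm_nonneg w)
      have h3 : -(s * w.re) ≤ |s| * ‖w‖ := by
        refine (neg_le_abs _).trans ?_
        rw [abs_mul]
        exact mul_le_mul_of_nonneg_left (abs_re_le_norm w) (abs_nonneg s)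
      calc ‖g (I * w)‖ * Real.exp (-(s * w.re))
          ≤ (c * Real.exp (s * ‖w‖)) * Real.exp (-(s * w.re)) := by gcongr
        _ = c * Real.exp (s * ‖w‖ + -(s * w.re)) := by rw [Real.exp_add, mul_assoc]
        _ ≤ c * Real.exp ((|s| + |s|) * ‖w‖) := by gcongr; linarith
    · refine isBoundedUnder_of_eventually_le (a := c) ?_
      filter_upwards [eventually_ge_atTop 0] with x hx
      rw [hn]
      have h1 : ‖g (I * x)‖ ≤ c * Real.exp (s * x) := by simpa [abs_of_nonneg hx] using hgc (I * x)
      rw [Real.exp_neg, ← div_eq_mul_inv, div_le_iff₀ (Real.exp_pos _)]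
      simpa using h1
    · intro x
      rw [hn]
      have h1 : I * (x * I) = ((-x : ℝ) : ℂ) := by
        rw [mul_left_comm, I_mul_I]; simp
      rw [h1]
      simpa using hM (-x)
  have hlim : Tendsto (fun ε : ℝ => M * Real.exp ((σ + ε) * z.im)) (𝓝[>] 0)
      (𝓝 (M * Real.exp (σ * z.im))) :=
    (Continuous.tendsto' (by fun_prop) _ _ (by simp)).mono_left nhdsWithin_le_nhds
  exact ge_of_tendsto hlim (eventually_mem_nhdsWithin.mono key)

/-- An entire function of exponential type at most `σ` that is bounded by `M` on the real line is
bounded by `M * exp (σ |Im z|)` in the whole plane. -/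
theorem IsEntireOfExpType.norm_le_mul_exp_abs_im {σ M : ℝ} {g : ℂ → ℂ}
    (hg : IsEntireOfExpType σ g) (hM : ∀ x : ℝ, ‖g x‖ ≤ M) (z : ℂ) :
    ‖g z‖ ≤ M * Real.exp (σ * |z.im|) := by
  rcases le_total 0 z.im with hz | hz
  · simpa [abs_of_nonneg hz] using hg.norm_le_mul_exp_im hM hz
  · have hg' : IsEntireOfExpType σ fun w => g (-w) :=
      ⟨hg.1.comp differentiable_neg, fun ε hε => by
        obtain ⟨c, hc, h⟩ := hg.2 ε hε
        exact ⟨c, hc, fun w => by simpa using h (-w)⟩⟩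
    have := hg'.norm_le_mul_exp_im (M := M) (fun x => by simpa using hM (-x)) (z := -z)
      (by simpa using hz)
    simpa [abs_of_nonpos hz] using this

/-! ### Residues at simple poles -/

/-- The residue theorem on a disc, for finitely many (at most) simple poles: `r s` is the residue
of `φ` at `s`. -/
theorem circleIntegral_eq_sum_residues {φ r : ℂ → ℂ} {c : ℂ} {R : ℝ} (S : Finset ℂ)
    (hS : ∀ s ∈ S, s ∈ ball c R) (hR : 0 ≤ R)
    (hd : ∀ z ∈ closedBall c R, z ∉ S → DifferentiableAt ℂ φ z)
    (hr : ∀ s ∈ S, Tendsto (fun z => (z - s) * φ z) (𝓝[≠] s) (𝓝 (r s))) :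
    (∮ z in C(c, R), φ z) = 2 * π * I * ∑ s ∈ S, r s := by
  have hsph : ∀ z ∈ sphere c R, z ∉ S := fun z hz hzS => by
    have h1 := hS z hzS
    rw [mem_ball] at h1; rw [mem_sphere] at hz; linarith
  set P : ℂ → ℂ := fun z => ∑ s ∈ S, r s * (z - s)⁻¹ with hP
  set ψ : ℂ → ℂ := fun z => φ z - P z with hψ
  have hPd : ∀ z, z ∉ S → DifferentiableAt ℂ P z := fun z hz => by
    refine DifferentiableAt.fun_sum fun s hs => ?_
    have : z - s ≠ 0 := sub_ne_zero.2 fun h => hz (h ▸ hs)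
    fun_prop (disch := assumption)
  have hψd : ∀ z ∈ closedBall c R, z ∉ S → DifferentiableAt ℂ ψ z := fun z hz hzS =>
    (hd z hz hzS).sub (hPd z hzS)
  -- Near a point of `S`, the disc contains no other point of `S`.
  have hnear : ∀ s ∈ S, ∀ᶠ z in 𝓝[≠] s, z ∈ ball c R ∧ z ∉ S := fun s hs => by
    have h1 : ∀ᶠ z in 𝓝 s, z ∈ ball c R := isOpen_ball.mem_nhds (hS s hs)
    have h2 : ∀ᶠ z in 𝓝 s, z ∉ S.erase s :=
      (S.erase s).finite_toSet.isClosed.isOpen_compl.mem_nhds (by simp)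
    filter_upwards [h1.filter_mono nhdsWithin_le_nhds, h2.filter_mono nhdsWithin_le_nhds,
      self_mem_nhdsWithin] with z hz1 hz2 hz3
    refine ⟨hz1, fun h => hz2 (Finset.mem_erase.2 ⟨hz3, h⟩)⟩
  -- After subtraction of the principal parts, every singularity is removable.
  have hlim0 : ∀ s ∈ S, Tendsto (fun z => (z - s) * ψ z) (𝓝[≠] s) (𝓝 0) := fun s hs => by
    have hrest : DifferentiableAt ℂ (fun z => ∑ t ∈ S.erase s, r t * (z - t)⁻¹) s := by
      refine DifferentiableAt.fun_sum fun t ht => ?_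
      have : s - t ≠ 0 := sub_ne_zero.2 (Finset.ne_of_mem_erase ht).symm
      fun_prop (disch := assumption)
    have h1 : Tendsto (fun z => (z - s) * ∑ t ∈ S.erase s, r t * (z - t)⁻¹) (𝓝[≠] s) (𝓝 0) := by
      have : ContinuousAt (fun z => (z - s) * ∑ t ∈ S.erase s, r t * (z - t)⁻¹) s :=
        (by fun_prop : ContinuousAt (fun z => z - s) s).mul hrest.continuousAt
      simpa using this.tendsto.mono_left nhdsWithin_le_nhds
    have h2 := ((hr s hs).sub (tendsto_const_nhds (x := r s))).sub h1
    simp only [sub_self] at h2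
    refine h2.congr' ?_
    filter_upwards [self_mem_nhdsWithin] with z hz
    have hz' : z - s ≠ 0 := sub_ne_zero.2 hz
    simp only [hψ, hP]
    rw [← Finset.add_sum_erase S _ hs]
    field_simp
    ring
  have hlim : ∀ s ∈ S, Tendsto ψ (𝓝[≠] s) (𝓝 (limUnder (𝓝[≠] s) ψ)) := fun s hs => by
    refine tendsto_limUnder_of_differentiable_on_punctured_nhds_of_isLittleO ?_ ?_
    · filter_upwards [hnear s hs] with z hz
      exact hψd z (ball_subset_closedBall hz.1) hz.2
    · refine isLittleO_of_tendsto' ?_ ?_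
      · filter_upwards [self_mem_nhdsWithin] with z hz h
        exact absurd h (inv_ne_zero (sub_ne_zero.2 hz))
      · have h1 : Tendsto (fun z => (z - s) * ψ s) (𝓝[≠] s) (𝓝 0) :=
          (Continuous.tendsto' (by fun_prop) _ _ (by simp)).mono_left nhdsWithin_le_nhds
        have h2 := (hlim0 s hs).sub h1
        rw [sub_zero] at h2
        refine h2.congr fun z => ?_
        rw [div_inv_eq_mul]; ring
  classical
  set ψ' : ℂ → ℂ := fun z => if z ∈ S then limUnder (𝓝[≠] z) ψ else ψ z with hψ'
  have hloc : ∀ z, z ∉ S → ψ' =ᶠ[𝓝 z] ψ := fun z hz => by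
    have : ∀ᶠ w in 𝓝 z, w ∉ S := S.finite_toSet.isClosed.isOpen_compl.mem_nhds (by simpa using hz)
    filter_upwards [this] with w hw
    simp [hψ', hw]
  have hd' : ∀ z ∈ closedBall c R, z ∉ S → DifferentiableAt ℂ ψ' z := fun z hz hzS =>
    (hψd z hz hzS).congr_of_eventuallyEq (hloc z hzS)
  have hzero : (∮ z in C(c, R), ψ' z) = 0 := by
    refine circleIntegral_eq_zero_of_differentiable_on_off_countable hR
      S.finite_toSet.countable (fun z hz => ?_)
      fun z hz => hd' z (ball_subset_closedBall hz.1) (by simpa using hz.2)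
    by_cases hzS : z ∈ S
    · refine ContinuousAt.continuousWithinAt ?_
      rw [continuousAt_iff_punctured_nhds]
      have : ψ' z = limUnder (𝓝[≠] z) ψ := by simp [hψ', hzS]
      rw [this]
      refine (hlim z hzS).congr' ?_
      filter_upwards [hnear z hzS] with w hw
      simp [hψ', hw.2]
    · exact (hd' z hz hzS).continuousAt.continuousWithinAt
  have hcongr : (∮ z in C(c, R), ψ' z) = ∮ z in C(c, R), ψ z :=
    circleIntegral.integral_congr hR fun z hz => by simp [hψ', hsph z hz]
  have hφi : CircleIntegrable φ c R := ContinuousOn.circleIntegrable hR fun z hz =>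
    (hd z (sphere_subset_closedBall hz) (hsph z hz)).continuousAt.continuousWithinAt
  have hti : ∀ s ∈ S, CircleIntegrable (fun z => r s * (z - s)⁻¹) c R := fun s hs =>
    ContinuousOn.circleIntegrable hR fun z hz => by
      have : z - s ≠ 0 := sub_ne_zero.2 fun h => hsph z hz (h ▸ hs)
      exact ContinuousAt.continuousWithinAt (by fun_prop (disch := assumption))
  have hPi : CircleIntegrable P c R := CircleIntegrable.fun_sum S hti
  have hPint : (∮ z in C(c, R), P z) = 2 * π * I * ∑ s ∈ S, r s := by
    rw [hP, circleIntegral.integral_fun_sum hti, Finset.mul_sum]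
    refine Finset.sum_congr rfl fun s hs => ?_
    rw [circleIntegral.integral_const_mul, circleIntegral.integral_sub_inv_of_mem_ball (hS s hs)]
    ring
  rw [← hPint, ← sub_eq_zero, ← circleIntegral.integral_sub hφi hPi, ← hzero, hcongr]

/-- The residue theorem for a quotient `f / E` whose denominator has simple zeros only. -/
theorem circleIntegral_div_eq_sum {f E E' : ℂ → ℂ} {c : ℂ} {R : ℝ} (S : Finset ℂ)
    (hS : ∀ s ∈ S, s ∈ ball c R) (hR : 0 ≤ R) (hf : Differentiable ℂ f)
    (hE : ∀ z, HasDerivAt E (E' z) z) (hE0 : ∀ s ∈ S, E s = 0) (hE' : ∀ s ∈ S, E' s ≠ 0)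
    (hne : ∀ z ∈ closedBall c R, z ∉ S → E z ≠ 0) :
    (∮ z in C(c, R), f z / E z) = 2 * π * I * ∑ s ∈ S, f s / E' s := by
  refine circleIntegral_eq_sum_residues S hS hR
    (fun z hz hzS => (hf z).div (hE z).differentiableAt (hne z hz hzS)) fun s hs => ?_
  have h1 := (hE s).tendsto_slope
  have h2 : Tendsto f (𝓝[≠] s) (𝓝 (f s)) := (hf s).continuousAt.tendsto.mono_left nhdsWithin_le_nhds
  refine (h2.div h1 (hE' s hs)).congr fun z => ?_
  rw [Pi.div_apply, slope_def_field, hE0 s hs, sub_zero, div_div_eq_mul_div]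
  ring

/-! ### The sharp Bernstein inequality for increments -/

theorem norm_sq_cos_eq (z : ℂ) : ‖cos z‖ ^ 2 = Real.cos z.re ^ 2 + Real.sinh z.im ^ 2 := by
  have h : cos z = ((Real.cos z.re * Real.cosh z.im : ℝ) : ℂ)
      + ((-(Real.sin z.re * Real.sinh z.im) : ℝ) : ℂ) * I := by
    rw [cos_eq z]; push_cast; ring
  rw [h, ← normSq_eq_norm_sq, normSq_add_mul_I, mul_pow, neg_sq, mul_pow, Real.cosh_sq,
    Real.sin_sq]
  ring

/-- On the circles `‖z‖ = N π`, which stay away from the zeros of the cosine, `cos z` has the full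
growth `exp |Im z|`, up to a constant. -/
theorem exp_abs_im_le_mul_norm_cos {N : ℕ} (hN : 1 ≤ N) {z : ℂ} (hz : ‖z‖ = N * π) :
    Real.exp |z.im| ≤ 4 * ‖cos z‖ := by
  rcases le_or_gt (1 / 2) |z.im| with hy | hy
  · have h1 : |Real.sinh z.im| ≤ ‖cos z‖ := by
      refine abs_le_of_sq_le_sq ?_ (norm_nonneg _)
      rw [norm_sq_cos_eq]
      nlinarith [sq_nonneg (Real.cos z.re)]
    rw [Real.abs_sinh, Real.sinh_eq] at h1
    have h2 : Real.exp (-|z.im|) * 2 ≤ Real.exp |z.im| := by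
      have h3 : 2 ≤ Real.exp (2 * |z.im|) := by
        have := Real.add_one_le_exp (2 * |z.im|); linarith
      calc Real.exp (-|z.im|) * 2 ≤ Real.exp (-|z.im|) * Real.exp (2 * |z.im|) := by gcongr
        _ = Real.exp |z.im| := by rw [← Real.exp_add]; ring_nf
    linarith
  · have hN' : (1 : ℝ) ≤ N := by exact_mod_cast hN
    have hpi := Real.pi_gt_three
    have hsq : z.re ^ 2 + z.im ^ 2 = (N * π) ^ 2 := by
      rw [← hz, ← normSq_eq_norm_sq, normSq_apply]; ring
    have hNpi : 3 ≤ N * π := by nlinarith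
    have hre : |z.re| ≤ N * π := hz ▸ abs_re_le_norm z
    -- `N π - |Re z|` is small, so that `|cos (Re z)|` is close to `1`.
    have hδ : N * π - |z.re| ≤ 1 := by
      have h1 : (N * π - |z.re|) * (N * π + |z.re|) = |z.im| ^ 2 := by
        rw [sq_abs]; nlinarith [sq_abs z.re]
      nlinarith [abs_nonneg z.re, abs_nonneg z.im]
    have hcos : 1 / 2 ≤ |Real.cos z.re| := by
      have h1 : |Real.cos z.re| = |Real.cos (N * π - |z.re|)| := by
        rw [Real.cos_nat_mul_pi_sub, Real.cos_abs, abs_mul, abs_pow, abs_neg, abs_one, one_pow,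
          one_mul]
      have h2 := Real.one_sub_sq_div_two_le_cos (x := N * π - |z.re|)
      rw [h1]
      refine le_trans ?_ (le_abs_self _)
      nlinarith
    have hcz : 1 / 2 ≤ ‖cos z‖ := by
      refine hcos.trans (abs_le_of_sq_le_sq ?_ (norm_nonneg _))
      rw [norm_sq_cos_eq]
      nlinarith [sq_nonneg (Real.sinh z.im)]
    have hexp : Real.exp |z.im| ≤ 2 := by
      have h1 : Real.exp |z.im| ≤ Real.exp (1 / 2) := Real.exp_le_exp.2 hy.le
      have h2 : Real.exp (1 / 2) * Real.exp (1 / 2) = Real.exp 1 := by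
        rw [← Real.exp_add]; norm_num
      have h3 := Real.exp_one_lt_d9
      nlinarith [Real.exp_pos (1 / 2)]
    linarith

theorem finite_cos_zeros_inter_ball (R : ℝ) : {z : ℂ | cos z = 0 ∧ ‖z‖ < R}.Finite := by
  obtain ⟨n, hn⟩ := exists_nat_ge R
  refine ((Set.finite_Icc (-n - 1 : ℤ) n).image fun k : ℤ => (2 * k + 1) * (π : ℂ) / 2).subset ?_
  rintro z ⟨hz, hzR⟩
  obtain ⟨k, rfl⟩ := cos_eq_zero_iff.1 hz
  refine ⟨k, ?_, rfl⟩
  have h1 : ‖(2 * k + 1) * (π : ℂ) / 2‖ = |(2 * k + 1 : ℝ)| * π / 2 := by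
    have : (2 * k + 1) * (π : ℂ) / 2 = ((((2 * k + 1) * π / 2 : ℝ)) : ℂ) := by push_cast; ring
    rw [this, norm_real, Real.norm_eq_abs, abs_div, abs_mul, abs_of_pos Real.pi_pos]
    norm_num
  rw [h1] at hzR
  have h2 : |(2 * k + 1 : ℝ)| < n := by
    nlinarith [Real.pi_gt_three, abs_nonneg (2 * k + 1 : ℝ)]
  obtain ⟨h3, h4⟩ := abs_lt.1 h2
  have h5 : (-(n : ℤ)) < 2 * k + 1 := by exact_mod_cast h3
  have h6 : 2 * k + 1 < (n : ℤ) := by exact_mod_cast h4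
  constructor <;> omega

theorem im_eq_zero_of_cos_eq_zero {z : ℂ} (hz : cos z = 0) : z.im = 0 := by
  have h := norm_sq_cos_eq z
  rw [hz, norm_zero] at h
  have : Real.sinh z.im ^ 2 = 0 := by
    nlinarith [sq_nonneg (Real.cos z.re), sq_nonneg (Real.sinh z.im)]
  simpa using this

theorem pi_div_two_le_abs_re_of_cos_eq_zero {z : ℂ} (hz : cos z = 0) : π / 2 ≤ |z.re| := by
  by_contra! h
  have h1 := Real.cos_pos_of_mem_Ioo (abs_lt.1 h)
  have h2 := norm_sq_cos_eq z
  rw [hz, norm_zero] at h2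
  nlinarith [sq_nonneg (Real.sinh z.im)]

/-- The zeros of the cosine in the open disc of radius `R`. -/
noncomputable def cosZeros (R : ℝ) : Finset ℂ := (finite_cos_zeros_inter_ball R).toFinset

theorem mem_cosZeros {R : ℝ} {z : ℂ} : z ∈ cosZeros R ↔ cos z = 0 ∧ ‖z‖ < R := by
  simp [cosZeros]

/-- The interpolation formula for the increment `g h - g (-h)`, with the remainder in the form of
a contour integral: the residues of `g z / ((z ^ 2 - h ^ 2) cos z)` at `±h` and at the zeros of the
cosine. -/
theorem circleIntegral_interpolation {g : ℂ → ℂ} (hg : Differentiable ℂ g) {h : ℝ} (hh0 : 0 < h)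
    (hh : h < π / 2) {N : ℕ} (hN : 1 ≤ N) :
    (∮ z in C(0, N * π), g z / ((z ^ 2 - h ^ 2) * cos z)) = 2 * π * I *
      ((g h - g (-h)) / (2 * h * cos h)
        - ∑ s ∈ cosZeros (N * π), g s / ((s ^ 2 - h ^ 2) * sin s)) := by
  have hN' : (1 : ℝ) ≤ N := by exact_mod_cast hN
  have hpi := Real.pi_gt_three
  have hR : h < N * π := by nlinarith
  have hhC : (h : ℂ) ≠ 0 := by exact_mod_cast hh0.ne'
  have hcosh : cos (h : ℂ) ≠ 0 := by
    rw [← ofReal_cos]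
    exact_mod_cast (Real.cos_pos_of_mem_Ioo ⟨by linarith, hh⟩).ne'
  have hneg : (h : ℂ) ≠ -h := fun e => hhC (by linear_combination e / 2)
  have hn1 : (-(h : ℂ)) ∉ cosZeros (N * π) := fun e => hcosh (by
    simpa using (mem_cosZeros.1 e).1)
  have hn2 : (h : ℂ) ∉ insert (-(h : ℂ)) (cosZeros (N * π)) := fun e => by
    rcases Finset.mem_insert.1 e with e | e
    · exact hneg e
    · exact hcosh (mem_cosZeros.1 e).1
  have hz2 : ∀ z ∈ cosZeros (N * π), z ^ 2 - (h : ℂ) ^ 2 ≠ 0 := fun z hz e => by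
    have e' : (z - h) * (z + h) = 0 := by linear_combination e
    rcases mul_eq_zero.1 e' with e1 | e1
    · exact hn2 (by rw [← sub_eq_zero.1 e1]; exact Finset.mem_insert_of_mem hz)
    · exact hn1 (by rw [← eq_neg_of_add_eq_zero_left e1]; exact hz)
  have hsin : ∀ z ∈ cosZeros (N * π), sin z ≠ 0 := fun z hz e => by
    have := sin_sq_add_cos_sq z
    rw [e, (mem_cosZeros.1 hz).1] at this
    norm_num at this
  have key := circleIntegral_div_eq_sum (f := g) (c := 0) (R := N * π)
    (E := fun z => (z ^ 2 - h ^ 2) * cos z)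
    (E' := fun z => 2 * z * cos z - (z ^ 2 - h ^ 2) * sin z)
    (insert (h : ℂ) (insert (-(h : ℂ)) (cosZeros (N * π)))) ?_ (by positivity) hg ?_ ?_ ?_ ?_
  · rw [key, Finset.sum_insert hn2, Finset.sum_insert hn1]
    congr 1
    have hsum : ∑ s ∈ cosZeros (N * π), g s / (2 * s * cos s - (s ^ 2 - h ^ 2) * sin s)
        = -∑ s ∈ cosZeros (N * π), g s / ((s ^ 2 - h ^ 2) * sin s) := by
      rw [← Finset.sum_neg_distrib]
      refine Finset.sum_congr rfl fun s hs => ?_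
      rw [(mem_cosZeros.1 hs).1, mul_zero, zero_sub, div_neg]
    have hminus : 2 * -(h : ℂ) * cos h = -(2 * h * cos h) := by ring
    rw [hsum, cos_neg, neg_sq, sub_self, zero_mul, sub_zero, zero_mul, sub_zero, hminus, div_neg,
      sub_div]
    ring
  · intro s hs
    simp only [Finset.mem_insert, mem_cosZeros] at hs
    rcases hs with rfl | rfl | hs
    · simpa [abs_of_pos hh0] using hR
    · simpa [abs_of_pos hh0] using hR
    · simpa using hs.2
  · intro z
    have h1 : HasDerivAt (fun z : ℂ => z ^ 2 - (h : ℂ) ^ 2) (2 * z) z := by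
      simpa using (hasDerivAt_pow 2 z).sub_const ((h : ℂ) ^ 2)
    refine (h1.mul (hasDerivAt_cos z)).congr_deriv ?_
    ring
  · intro s hs
    simp only [Finset.mem_insert, mem_cosZeros] at hs
    rcases hs with rfl | rfl | hs
    · simp
    · simp
    · simp [hs.1]
  · intro s hs
    rcases Finset.mem_insert.1 hs with rfl | hs
    · simp [hhC, hcosh]
    rcases Finset.mem_insert.1 hs with rfl | hs
    · simp [hhC, hcosh]
    · simp [(mem_cosZeros.1 hs).1, hz2 s hs, hsin s hs]
  · intro z hz hzS e
    rcases mul_eq_zero.1 e with e1 | e1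
    · have e' : (z - h) * (z + h) = 0 := by linear_combination e1
      rcases mul_eq_zero.1 e' with e2 | e2
      · exact hzS (by simp [sub_eq_zero.1 e2])
      · exact hzS (by simp [eq_neg_of_add_eq_zero_left e2])
    · -- The circle itself carries no zero of the cosine.
      have hle : ‖z‖ ≤ N * π := by simpa using hz
      rcases hle.lt_or_eq with hlt | heq
      · exact hzS (by simp [mem_cosZeros, e1, hlt])
      · have := exp_abs_im_le_mul_norm_cos hN heq
        rw [e1, norm_zero, mul_zero] at this
        exact absurd this (not_le.2 (Real.exp_pos _))

/-- The remainder in the interpolation formula is `O(1 / N)`. -/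
theorem norm_interpolation_remainder_le {g : ℂ → ℂ} (hg : Differentiable ℂ g) {M : ℝ}
    (hM : ∀ z, ‖g z‖ ≤ M * Real.exp |z.im|) {h : ℝ} (hh0 : 0 < h) (hh : h < π / 2) {N : ℕ}
    (hN : 1 ≤ N) :
    ‖(g h - g (-h)) / (2 * h * cos h)
        - ∑ s ∈ cosZeros (N * π), g s / ((s ^ 2 - h ^ 2) * sin s)‖
      ≤ N * π * (4 * M / ((N * π) ^ 2 - h ^ 2)) := by
  have hN' : (1 : ℝ) ≤ N := by exact_mod_cast hN
  have hpi := Real.pi_gt_three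
  have hR : h < N * π := by nlinarith
  have hpos : 0 < (N * π) ^ 2 - h ^ 2 := by nlinarith
  have hM0 : 0 ≤ M := by simpa using (norm_nonneg _).trans (hM 0)
  have hb : ‖∮ z in C(0, N * π), g z / ((z ^ 2 - h ^ 2) * cos z)‖
      ≤ 2 * π * (N * π) * (4 * M / ((N * π) ^ 2 - h ^ 2)) := by
    refine circleIntegral.norm_integral_le_of_norm_le_const (by positivity) fun z hz => ?_
    have hz' : ‖z‖ = N * π := by simpa using hz
    have hc := exp_abs_im_le_mul_norm_cos hN hz'
    have hcpos : 0 < ‖cos z‖ := by linarith [Real.exp_pos |z.im|]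
    have hq : (N * π) ^ 2 - h ^ 2 ≤ ‖z ^ 2 - (h : ℂ) ^ 2‖ := by
      have := norm_sub_norm_le (z ^ 2) ((h : ℂ) ^ 2)
      rwa [norm_pow, norm_pow, hz', norm_real, Real.norm_eq_abs, sq_abs] at this
    rw [norm_div, norm_mul, div_le_div_iff₀ (mul_pos (hpos.trans_le hq) hcpos) hpos]
    calc ‖g z‖ * ((N * π) ^ 2 - h ^ 2)
        ≤ M * (4 * ‖cos z‖) * ‖z ^ 2 - (h : ℂ) ^ 2‖ := by
          gcongr
          exact (hM z).trans (by gcongr)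
      _ = 4 * M * (‖z ^ 2 - (h : ℂ) ^ 2‖ * ‖cos z‖) := by ring
  rw [circleIntegral_interpolation hg hh0 hh hN, norm_mul] at hb
  have h2 : ‖(2 * π * I : ℂ)‖ = 2 * π := by simp [abs_of_pos Real.pi_pos]
  rw [h2, mul_assoc (2 * π)] at hb
  exact le_of_mul_le_mul_left hb (by positivity)

/-- In the interpolation formula for `g h - g (-h)` the coefficients of the values of `g` have
the modulus of the coefficients in the formula for the sine, all of whose terms are positive. So
the sine is extremal. -/
theorem norm_sub_neg_le_of_exp_abs_im {g : ℂ → ℂ} (hg : Differentiable ℂ g) {M : ℝ}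
    (hM : ∀ z, ‖g z‖ ≤ M * Real.exp |z.im|) {h : ℝ} (hh0 : 0 < h) (hh : h < π / 2) :
    ‖g h - g (-h)‖ ≤ 2 * Real.sin h * M := by
  have hM0 : 0 ≤ M := by simpa using (norm_nonneg _).trans (hM 0)
  have hcos : 0 < Real.cos h := Real.cos_pos_of_mem_Ioo ⟨by linarith, hh⟩
  have hsinM : ∀ z : ℂ, ‖sin z‖ ≤ 1 * Real.exp |z.im| := fun z => by
    have h1 : ‖cexp (-z * I)‖ ≤ Real.exp |z.im| := by
      rw [norm_exp]; exact Real.exp_le_exp.2 (by simpa using le_abs_self z.im)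
    have h2 : ‖cexp (z * I)‖ ≤ Real.exp |z.im| := by
      rw [norm_exp]; exact Real.exp_le_exp.2 (by simpa using neg_le_abs z.im)
    rw [sin, norm_div, norm_mul, norm_I, mul_one]
    have h3 := norm_sub_le (cexp (-z * I)) (cexp (z * I))
    rw [Complex.norm_ofNat]
    linarith
  set D : ℝ := 2 * h * Real.cos h with hD
  have hDpos : 0 < D := by positivity
  have hDC : (2 * h * cos h : ℂ) = (D : ℂ) := by rw [hD]; push_cast; ring
  set e : ℕ → ℝ := fun N => N * π * (4 / ((N * π) ^ 2 - h ^ 2)) with he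
  have hmain : ∀ N : ℕ, 1 ≤ N →
      ‖g h - g (-h)‖ / D ≤ M * (2 * Real.sin h / D) + 2 * M * e N := by
    intro N hN
    have hA := norm_interpolation_remainder_le hg hM hh0 hh hN
    have hB := norm_interpolation_remainder_le differentiable_sin hsinM hh0 hh hN
    rw [hDC] at hA hB
    set W : ℝ := ∑ s ∈ cosZeros (N * π), 1 / (s.re ^ 2 - h ^ 2) with hW
    have hs : ∀ s ∈ cosZeros (N * π), (s : ℂ) = (s.re : ℂ) ∧ 0 < s.re ^ 2 - h ^ 2 ∧ ‖sin s‖ = 1 ∧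
        sin s ≠ 0 := fun s hs => by
      have hc := (mem_cosZeros.1 hs).1
      have h1 := im_eq_zero_of_cos_eq_zero hc
      have h2 := pi_div_two_le_abs_re_of_cos_eq_zero hc
      have h3 : ‖sin s‖ = 1 := by
        have h4 := sin_sq_add_cos_sq s
        rw [hc, zero_pow two_ne_zero, add_zero] at h4
        have h5 : ‖sin s‖ ^ 2 = 1 := by rw [← norm_pow, h4, norm_one]
        exact (pow_eq_one_iff_of_nonneg (norm_nonneg _) two_ne_zero).1 h5
      refine ⟨Complex.ext rfl (by simpa using h1), ?_, h3, fun h0 => by simp [h0] at h3⟩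
      rw [← sq_abs s.re]
      nlinarith
    have hgsum : ‖∑ s ∈ cosZeros (N * π), g s / ((s ^ 2 - h ^ 2) * sin s)‖ ≤ M * W := by
      rw [hW, Finset.mul_sum]
      refine norm_sum_le_of_le _ fun s hsz => ?_
      obtain ⟨h1, h2, h3, -⟩ := hs s hsz
      have h4 : ‖s ^ 2 - (h : ℂ) ^ 2‖ = s.re ^ 2 - h ^ 2 := by
        rw [h1, ← ofReal_pow, ← ofReal_pow, ← ofReal_sub, norm_real, Real.norm_of_nonneg]
        · simp
        · simpa using h2.le
      have h5 : ‖g s‖ ≤ M := by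
        have := hM s
        rw [im_eq_zero_of_cos_eq_zero (mem_cosZeros.1 hsz).1] at this
        simpa using this
      rw [norm_div, norm_mul, h3, h4, mul_one, mul_one_div]
      gcongr
    have hsinsum : ∑ s ∈ cosZeros (N * π), sin s / ((s ^ 2 - h ^ 2) * sin s) = (W : ℂ) := by
      rw [hW, ofReal_sum]
      refine Finset.sum_congr rfl fun s hsz => ?_
      obtain ⟨h1, h2, -, h3⟩ := hs s hsz
      rw [mul_comm, div_mul_eq_div_div, div_self h3]
      conv_lhs => rw [h1]
      push_cast
      rfl
    have hBW : W ≤ 2 * Real.sin h / D + e N := by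
      have h1 : (sin (h : ℂ) - sin (-(h : ℂ))) / (D : ℂ) - (W : ℂ)
          = ((2 * Real.sin h / D - W : ℝ) : ℂ) := by
        rw [sin_neg]; push_cast; ring
      rw [hsinsum, h1, norm_real, Real.norm_eq_abs] at hB
      have h2 := (neg_le_abs _).trans hB
      rw [mul_one] at h2
      linarith
    have hA' := norm_sub_norm_le ((g h - g (-h)) / (D : ℂ))
      (∑ s ∈ cosZeros (N * π), g s / ((s ^ 2 - h ^ 2) * sin s))
    rw [norm_div, norm_real, Real.norm_of_nonneg hDpos.le] at hA'
    have hAe : N * π * (4 * M / ((N * π) ^ 2 - h ^ 2)) = M * e N := by rw [he]; ring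
    have := mul_le_mul_of_nonneg_left hBW hM0
    linarith
  have he0 : Tendsto e atTop (𝓝 0) := by
    have hR : Tendsto (fun N : ℕ => (N : ℝ) * π) atTop atTop :=
      tendsto_natCast_atTop_atTop.atTop_mul_const Real.pi_pos
    have h1 : Tendsto (fun x : ℝ => 4 * x⁻¹ / (1 - h ^ 2 * (x⁻¹) ^ 2)) atTop (𝓝 0) := by
      have hi := tendsto_inv_atTop_zero (𝕜 := ℝ)
      have h2 := (hi.const_mul 4).div (((hi.pow 2).const_mul (h ^ 2)).const_sub 1) (by simp)
      simpa [Pi.div_def] using h2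
    refine (h1.comp hR).congr' ?_
    filter_upwards [eventually_ge_atTop 1] with N hN
    have hx : (N : ℝ) * π ≠ 0 := by positivity
    simp only [Function.comp, he]
    generalize (N : ℝ) * π = x at hx
    have h3 : 1 - h ^ 2 * (x⁻¹) ^ 2 = (x ^ 2 - h ^ 2) / x ^ 2 := by field_simp
    rw [h3, div_div_eq_mul_div]
    field_simp
  have hlim : Tendsto (fun N => M * (2 * Real.sin h / D) + 2 * M * e N) atTop
      (𝓝 (M * (2 * Real.sin h / D))) := by
    simpa using (he0.const_mul (2 * M)).const_add (M * (2 * Real.sin h / D))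
  have hfin := ge_of_tendsto hlim ((eventually_ge_atTop 1).mono hmain)
  rw [div_le_iff₀ hDpos] at hfin
  calc ‖g h - g (-h)‖ ≤ M * (2 * Real.sin h / D) * D := hfin
    _ = 2 * Real.sin h * M := by field_simp

/-- Bernstein's inequality for increments, with the sharp constant. -/
theorem IsEntireOfExpType.norm_sub_le_beta_mul {τ M : ℝ} (hτ : 0 < τ) {g : ℂ → ℂ}
    (hg : IsEntireOfExpType τ g) (hM : ∀ x : ℝ, ‖g x‖ ≤ M) : ‖g 0 - g 1‖ ≤ beta τ * M := by
  have htriv : ‖g 0 - g 1‖ ≤ 2 * M := by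
    have h0 := hM 0
    have h1 := hM 1
    simp only [ofReal_zero, ofReal_one] at h0 h1
    linarith [norm_sub_le (g 0) (g 1)]
  unfold beta
  split_ifs with hle
  · rcases hle.lt_or_eq with hlt | rfl
    · have hτC : (τ : ℂ) ≠ 0 := by exact_mod_cast hτ.ne'
      -- The affine change of variable takes `±τ / 2` to `0` and `1`, and the type to `1`.
      have key := norm_sub_neg_le_of_exp_abs_im (g := fun w => g (1 / 2 - w / τ)) (M := M)
        (h := τ / 2) (hg.1.comp (by fun_prop)) (fun w => ?_) (by linarith) (by linarith)
      · have e1 : (1 / 2 - ((τ / 2 : ℝ) : ℂ) / τ) = 0 := by push_cast; field_simp; norm_num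
        have e2 : (1 / 2 - -((τ / 2 : ℝ) : ℂ) / τ) = 1 := by push_cast; field_simp; norm_num
        simpa only [e1, e2] using key
      · have h1 := hg.norm_le_mul_exp_abs_im hM (1 / 2 - w / τ)
        have h2 : (1 / 2 - w / τ : ℂ).im = -(w.im / τ) := by
          simp [div_ofReal_im]
        rwa [h2, abs_neg, abs_div, abs_of_pos hτ, mul_div_cancel₀ _ hτ.ne'] at h1
    · simpa using htriv
  · exact htriv

/-! ### Taylor series in an operator argument -/

/-- The Taylor coefficients of `f` at the origin. -/
noncomputable def taylorCoeff (f : ℂ → ℂ) (n : ℕ) : ℂ :=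
  (n.factorial : ℂ)⁻¹ * iteratedDeriv n f 0

theorem tsum_taylorCoeff_mul_pow {f : ℂ → ℂ} (hf : Differentiable ℂ f) (z : ℂ) :
    ∑' n, taylorCoeff f n * z ^ n = f z := by
  simpa [taylorCoeff] using taylorSeries_eq_of_entire' (c := 0) (z := z) hf

/-- Cauchy's estimate on the circle of radius `q r`. For `q > 1` it is summable over `n`, at the
price of the factor `q` in the exponent. -/
theorem norm_taylorCoeff_mul_pow_le {f : ℂ → ℂ} (hf : Differentiable ℂ f) {c s : ℝ}
    (hexp : ∀ z, ‖f z‖ ≤ c * Real.exp (s * ‖z‖)) {r q : ℝ} (hr : 0 < r) (hq : 0 < q) (n : ℕ) :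
    ‖taylorCoeff f n‖ * r ^ n ≤ c * Real.exp (s * (q * r)) * q⁻¹ ^ n := by
  have h := norm_iteratedDeriv_le_of_forall_mem_sphere_norm_le (c := 0) (R := q * r)
    (C := c * Real.exp (s * (q * r))) n (by positivity) hf.diffContOnCl fun z hz => by
      have h1 := hexp z
      rwa [mem_sphere_zero_iff_norm.1 hz] at h1
  have hfac : (0 : ℝ) < n.factorial := by exact_mod_cast n.factorial_pos
  rw [taylorCoeff, norm_mul, norm_inv, norm_natCast]
  calc (n.factorial : ℝ)⁻¹ * ‖iteratedDeriv n f 0‖ * r ^ n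
      ≤ (n.factorial : ℝ)⁻¹ * (n.factorial * (c * Real.exp (s * (q * r))) / (q * r) ^ n)
          * r ^ n := by gcongr
    _ = c * Real.exp (s * (q * r)) * q⁻¹ ^ n := by
      rw [mul_pow, inv_pow]; field_simp

/-- The majorant series `∑ |aₙ| rⁿ` has the same exponential type as `f` itself. -/
theorem IsEntireOfExpType.exists_tsum_norm_le {σ : ℝ} (hσ : 0 < σ) {f : ℂ → ℂ}
    (hf : IsEntireOfExpType σ f) {ε : ℝ} (hε : 0 < ε) :
    ∃ C : ℝ, 0 < C ∧ ∀ r : ℝ, 0 < r → Summable (fun n => ‖taylorCoeff f n‖ * r ^ n) ∧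
      ∑' n, ‖taylorCoeff f n‖ * r ^ n ≤ C * Real.exp ((σ + ε) * r) := by
  obtain ⟨c, hc, hexp⟩ := hf.2 (ε / 2) (by positivity)
  -- The radius of Cauchy's circle is `q r`, where `q > 1` is so close to `1` that the type of `f`
  -- grows to `σ + ε` only.
  set q : ℝ := (σ + ε) / (σ + ε / 2) with hq
  have hq1 : 1 < q := by rw [hq, one_lt_div (by positivity)]; linarith
  have hq0 : 0 < q := by linarith
  have hgeo := hasSum_geometric_of_lt_one (inv_nonneg.2 hq0.le) (inv_lt_one_of_one_lt₀ hq1)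
  have hpos : 0 < (1 - q⁻¹)⁻¹ := inv_pos.2 (sub_pos.2 (inv_lt_one_of_one_lt₀ hq1))
  refine ⟨c * (1 - q⁻¹)⁻¹, by positivity, fun r hr => ?_⟩
  have hb := norm_taylorCoeff_mul_pow_le hf.1 hexp hr hq0
  have he : (σ + ε / 2) * (q * r) = (σ + ε) * r := by
    rw [hq]; field_simp
  rw [he] at hb
  have hS := hgeo.mul_left (c * Real.exp ((σ + ε) * r))
  have hsum : Summable (fun n => ‖taylorCoeff f n‖ * r ^ n) :=
    .of_nonneg_of_le (fun n => by positivity) hb hS.summable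
  refine ⟨hsum, (hsum.tsum_le_tsum hb hS.summable).trans_eq ?_⟩
  rw [hS.tsum_eq]; ring

theorem IsEntireOfExpType.summable_norm {σ : ℝ} (hσ : 0 < σ) {f : ℂ → ℂ}
    (hf : IsEntireOfExpType σ f) {r : ℝ} (hr : 0 < r) :
    Summable (fun n => ‖taylorCoeff f n‖ * r ^ n) :=
  let ⟨_, _, h⟩ := hf.exists_tsum_norm_le hσ one_pos
  (h r hr).1

/-- Unlike `norm_pow_le`, this covers the trivial space, where `‖1‖ = 0`. -/
theorem norm_pow_le_pow {H : Type*} [NormedAddCommGroup H] [InnerProductSpace ℂ H]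
    (T : H →L[ℂ] H) (n : ℕ) : ‖T ^ n‖ ≤ ‖T‖ ^ n := by
  rcases n.eq_zero_or_pos with rfl | hn
  · rw [pow_zero, pow_zero]
    exact ContinuousLinearMap.norm_id_le
  · exact norm_pow_le' T hn

section Operators

variable {H : Type*} [NormedAddCommGroup H] [InnerProductSpace ℂ H] [CompleteSpace H]

theorem norm_opFun_le {g : ℝ → ℂ} {M : ℝ} (hM : ∀ x, ‖g x‖ ≤ M) (T : H →L[ℂ] H) :
    ‖opFun g T‖ ≤ M :=
  norm_cfc_le ((norm_nonneg _).trans (hM 0)) fun z _ => hM z.re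

theorem hasSum_opFun {σ : ℝ} (hσ : 0 < σ) {f : ℂ → ℂ} (hf : IsEntireOfExpType σ f)
    {T : H →L[ℂ] H} (hT : IsSelfAdjoint T) :
    HasSum (fun n => taylorCoeff f n • T ^ n) (opFun (fun x : ℝ => f x) T) := by
  have hTn : IsStarNormal T := hT.isStarNormal
  have hcongr : opFun (fun x : ℝ => f x) T = cfc (fun z => ∑' n, taylorCoeff f n * z ^ n) T := by
    refine cfc_congr fun z hz => ?_
    simp only [tsum_taylorCoeff_mul_pow hf.1]
    rw [← hT.mem_spectrum_eq_re hz]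
  have hpart : ∀ s : Finset ℕ, cfc (fun z => ∑ n ∈ s, taylorCoeff f n * z ^ n) T
      = ∑ n ∈ s, taylorCoeff f n • T ^ n := fun s => by
    have h1 := cfc_sum (fun n (z : ℂ) => taylorCoeff f n * z ^ n) T s
    have h2 : (∑ n ∈ s, fun z : ℂ => taylorCoeff f n * z ^ n)
        = fun z => ∑ n ∈ s, taylorCoeff f n * z ^ n := by ext z; simp
    rw [h2] at h1
    rw [h1]
    refine Finset.sum_congr rfl fun n _ => ?_
    rw [cfc_const_mul .., cfc_pow_id ..]
  rw [hcongr]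
  simp only [HasSum, SummationFilter.unconditional_filter, ← hpart]
  refine tendsto_cfc_fun ?_ (Eventually.of_forall fun s => by fun_prop)
  refine tendstoUniformlyOn_tsum (hf.summable_norm hσ (r := ‖T‖ + 1) (by positivity))
    fun n z hz => ?_
  rw [norm_mul, norm_pow]
  have : ‖z‖ ≤ ‖T‖ + 1 := by
    have h1 := spectrum.norm_le_norm_mul_of_mem hz
    have h2 : ‖(1 : H →L[ℂ] H)‖ ≤ 1 := ContinuousLinearMap.norm_id_le
    nlinarith [norm_nonneg T]
  gcongr

/-- The function `z ↦ φ (f (A + z K))`, through the Taylor series of `f`. -/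
noncomputable def pencilFun (f : ℂ → ℂ) (φ : StrongDual ℂ (H →L[ℂ] H)) (A K : H →L[ℂ] H) (z : ℂ) :
    ℂ :=
  ∑' n, taylorCoeff f n * φ ((A + z • K) ^ n)

theorem norm_taylorCoeff_mul_apply_le (f : ℂ → ℂ) {φ : StrongDual ℂ (H →L[ℂ] H)} (hφ : ‖φ‖ ≤ 1)
    (A K : H →L[ℂ] H) {z : ℂ} {r : ℝ} (hr : ‖A‖ + ‖z‖ * ‖K‖ ≤ r) (n : ℕ) :
    ‖taylorCoeff f n * φ ((A + z • K) ^ n)‖ ≤ ‖taylorCoeff f n‖ * r ^ n := by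
  have h1 : ‖A + z • K‖ ≤ r := (norm_add_le _ _).trans (by rwa [norm_smul])
  rw [norm_mul]
  gcongr
  calc ‖φ ((A + z • K) ^ n)‖ ≤ 1 * ‖(A + z • K) ^ n‖ := φ.le_of_opNorm_le hφ _
    _ ≤ r ^ n := by
      rw [one_mul]
      exact (norm_pow_le_pow _ n).trans (by gcongr)

theorem differentiable_pencilFun {σ : ℝ} (hσ : 0 < σ) {f : ℂ → ℂ} (hf : IsEntireOfExpType σ f)
    {φ : StrongDual ℂ (H →L[ℂ] H)} (hφ : ‖φ‖ ≤ 1) (A K : H →L[ℂ] H) :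
    Differentiable ℂ (pencilFun f φ A K) := by
  intro z
  refine DifferentiableOn.differentiableAt (s := ball 0 (‖z‖ + 1)) ?_
    (isOpen_ball.mem_nhds (by simp))
  refine differentiableOn_tsum_of_summable_norm
    (hf.summable_norm hσ (r := ‖A‖ + (‖z‖ + 1) * ‖K‖ + 1) (by positivity)) (fun n => ?_)
    isOpen_ball fun n w hw => norm_taylorCoeff_mul_apply_le f hφ A K ?_ n
  · have h1 : Differentiable ℂ fun w : ℂ => (A + w • K) ^ n := by fun_prop
    exact ((φ.differentiable.comp h1).const_mul _).differentiableOn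
  · have : ‖w‖ ≤ ‖z‖ + 1 := (mem_ball_zero_iff.1 hw).le
    have : ‖w‖ * ‖K‖ ≤ (‖z‖ + 1) * ‖K‖ := by gcongr
    linarith

theorem isEntireOfExpType_pencilFun {σ : ℝ} (hσ : 0 < σ) {f : ℂ → ℂ}
    (hf : IsEntireOfExpType σ f) {φ : StrongDual ℂ (H →L[ℂ] H)} (hφ : ‖φ‖ ≤ 1) (A : H →L[ℂ] H)
    {K : H →L[ℂ] H} (hK : 0 < ‖K‖) : IsEntireOfExpType (σ * ‖K‖) (pencilFun f φ A K) := by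
  refine ⟨differentiable_pencilFun hσ hf hφ A K, fun ε hε => ?_⟩
  obtain ⟨C, hC, h⟩ := hf.exists_tsum_norm_le hσ (ε := ε / ‖K‖) (by positivity)
  refine ⟨C * Real.exp ((σ + ε / ‖K‖) * (‖A‖ + 1)), by positivity, fun z => ?_⟩
  obtain ⟨hs, hle⟩ := h (‖A‖ + 1 + ‖z‖ * ‖K‖) (by positivity)
  refine (tsum_of_norm_bounded hs.hasSum fun n =>
    norm_taylorCoeff_mul_apply_le f hφ A K (by linarith) n).trans (hle.trans_eq ?_)
  rw [mul_assoc, ← Real.exp_add]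
  congr 2
  field_simp

theorem pencilFun_ofReal {σ : ℝ} (hσ : 0 < σ) {f : ℂ → ℂ} (hf : IsEntireOfExpType σ f)
    (φ : StrongDual ℂ (H →L[ℂ] H)) {A K : H →L[ℂ] H} (hA : IsSelfAdjoint A) (hK : IsSelfAdjoint K)
    (x : ℝ) : pencilFun f φ A K x = φ (opFun (fun x : ℝ => f x) (A + (x : ℂ) • K)) := by
  have hx : IsSelfAdjoint ((x : ℂ) • K) := IsSelfAdjoint.smul (by simp [IsSelfAdjoint]) hK
  have h := (hasSum_opFun hσ hf (hA.add hx)).mapL φ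
  simpa [pencilFun] using h.tsum_eq

/-- The scalar inequality, applied to `z ↦ φ (f (A + z (B - A)))`, where the functional `φ` norms
the difference `f(A) - f(B)`. -/
theorem norm_opFun_sub_le {σ : ℝ} (hσ : 0 < σ) {f : ℂ → ℂ} (hf : IsEntireOfExpType σ f) {M : ℝ}
    (hM : ∀ x : ℝ, ‖f x‖ ≤ M) {A B : H →L[ℂ] H} (hA : IsSelfAdjoint A) (hB : IsSelfAdjoint B) :
    ‖opFun (fun x : ℝ => f x) A - opFun (fun x : ℝ => f x) B‖ ≤ beta (σ * ‖A - B‖) * M := by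
  rcases eq_or_ne A B with rfl | hne
  · simp [beta, Real.pi_pos.le]
  have hK : 0 < ‖B - A‖ := norm_pos_iff.2 (sub_ne_zero.2 hne.symm)
  obtain ⟨φ, hφ, hφe⟩ := exists_dual_vector'' ℂ
    (opFun (fun x : ℝ => f x) A - opFun (fun x : ℝ => f x) B)
  have hreal := pencilFun_ofReal hσ hf φ hA (hB.sub hA)
  have key := (isEntireOfExpType_pencilFun hσ hf hφ A hK).norm_sub_le_beta_mul
    (M := M) (by positivity) fun x => by
      rw [hreal]
      exact (φ.le_of_opNorm_le hφ _).trans (by simpa using norm_opFun_le hM _)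
  have h0 := hreal 0
  have h1 := hreal 1
  simp only [ofReal_zero, ofReal_one, zero_smul, one_smul, add_zero, add_sub_cancel] at h0 h1
  rw [h0, h1, ← map_sub, hφe, norm_sub_rev B A] at key
  simpa using key

end Operators

theorem beta_le_self {t : ℝ} (ht : 0 ≤ t) : beta t ≤ t := by
  unfold beta
  split_ifs with h
  · linarith [Real.sin_le (show 0 ≤ t / 2 by linarith)]
  · linarith [Real.pi_gt_three]

end OperatorBernstein

theorem mainTheorem1 (σ : ℝ) (hσ : 0 < σ) (f : ℂ → ℂ)
    (hf : OperatorBernstein.IsEntireOfExpType σ f)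
    (hb : OperatorBernstein.IsBoundedOnReal (fun x : ℝ => f x)) :
    (∀ (H : Type u) [NormedAddCommGroup H] [InnerProductSpace ℂ H] [CompleteSpace H]
      (A B : H →L[ℂ] H), IsSelfAdjoint A → IsSelfAdjoint B →
        ‖OperatorBernstein.opFun (fun x : ℝ => f x) A
            - OperatorBernstein.opFun (fun x : ℝ => f x) B‖
          ≤ OperatorBernstein.beta (σ * ‖A - B‖)
              * OperatorBernstein.supNorm (fun x : ℝ => f x) ∧
        OperatorBernstein.beta (σ * ‖A - B‖) * OperatorBernstein.supNorm (fun x : ℝ => f x)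
          ≤ σ * OperatorBernstein.supNorm (fun x : ℝ => f x) * ‖A - B‖) ∧
    OperatorBernstein.IsOperatorLipschitz.{u} (fun x : ℝ => f x) ∧
    OperatorBernstein.olNorm.{u} (fun x : ℝ => f x)
      ≤ ENNReal.ofReal (σ * OperatorBernstein.supNorm (fun x : ℝ => f x)) := by
  have hM : ∀ x : ℝ, ‖f x‖ ≤ OperatorBernstein.supNorm (fun x : ℝ => f x) := le_ciSup hb
  have hM0 := (norm_nonneg _).trans (hM 0)
  have hmain : ∀ (H : Type u) [NormedAddCommGroup H] [InnerProductSpace ℂ H] [CompleteSpace H]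
      (A B : H →L[ℂ] H), IsSelfAdjoint A → IsSelfAdjoint B →
        ‖OperatorBernstein.opFun (fun x : ℝ => f x) A
            - OperatorBernstein.opFun (fun x : ℝ => f x) B‖
          ≤ OperatorBernstein.beta (σ * ‖A - B‖)
              * OperatorBernstein.supNorm (fun x : ℝ => f x) ∧
        OperatorBernstein.beta (σ * ‖A - B‖) * OperatorBernstein.supNorm (fun x : ℝ => f x)
          ≤ σ * OperatorBernstein.supNorm (fun x : ℝ => f x) * ‖A - B‖ := by
    intro H _ _ _ A B hA hB
    refine ⟨OperatorBernstein.norm_opFun_sub_le hσ hf hM hA hB, ?_⟩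
    rw [mul_right_comm]
    exact mul_le_mul_of_nonneg_right (OperatorBernstein.beta_le_self (by positivity)) hM0
  have hol : OperatorBernstein.olNorm.{u} (fun x : ℝ => f x)
      ≤ ENNReal.ofReal (σ * OperatorBernstein.supNorm (fun x : ℝ => f x)) := by
    unfold OperatorBernstein.olNorm
    refine iSup_le fun H => iSup_le fun _ => iSup_le fun _ => iSup_le fun _ => iSup_le fun A =>
      iSup_le fun B => iSup_le fun hA => iSup_le fun hB => iSup_le fun hne => ?_
    obtain ⟨h1, h2⟩ := hmain H A B hA hB
    refine ENNReal.ofReal_le_ofReal ?_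
    rw [div_le_iff₀ (norm_pos_iff.2 (sub_ne_zero.2 hne))]
    exact h1.trans h2
  exact ⟨hmain, ⟨hf.1.continuous.comp Complex.continuous_ofReal,
    hol.trans_lt ENNReal.ofReal_lt_top⟩, hol⟩
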